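/- **Setting.** Let $K\ge 1$ and consider a ReLU network with activations $x_k\in\mathbb R^{n_k}$ ($0\le k\le K$) and layers $x_{k+1}=\pi_k(x_k)=\mathrm{ReLU}(w_kx_k+b_k)$ for $0\le k\le K-1$, a linear specification $\psi(x_K)=c^\top x_K$, and boxes $\mathcal X_k=[l_k,u_k]\subset\mathbb R^{n_k}$ with $l_0\le u_0$ and $\pi_k(\mathcal X_k)\subseteq\mathcal X_{k+1}$ for $0\le k\le K-1$. Inputs range over $\mathcal X_0$. **Functional Lagrangian dual.** Let $\lambda_0=0$, $\lambda_k(x)=q_k^\top x+\tfrac12x^\top Q_kx$ with $Q_k$ symmetric for $1\le k\le K-1$, and $\lambda_K(x)=q_K^\top x$; set $q_0=0$, $Q_0=0$, $Q_K=0$. The functional Lagrangian dual function is $$g(\lambda)=\sum_{k=0}^{K-1}\max_{x\in\mathcal X_k}\bigl[\lambda_{k+1}(\pi_k(x))-\lambda_k(x)\bigr]+\max_{x\in\mathcal X_K}\bigl[c^\top x-\lambda_K(x)\bigr].$$ The $k$-th inner problem ($0\le k\le K-1$), with $x\in\mathbb R^{n_k}$ and $y\in\mathbb R^{n_{k+1}}$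 the input and output of layer $k$, is relaxed to the two-layer SDP $$s_k(\lambda)=\sup_{P\in\Delta_k}\; q_{k+1}^\top P[y]+\tfrac12\mathrm{Tr}(Q_{k+1}P[yy^\top])-q_k^\top P[x]-\tfrac12\mathrm{Tr}(Q_kP[xx^\top]),$$ where $\Delta_k$ is the set of symmetric matrices $$P=\begin{pmatrix}1&P[y]^\top&P[x]^\top\\P[y]&P[yy^\top]&P[yx^\top]\\P[x]&P[xy^\top]&P[xx^\top]\end{pmatrix}\succeq0$$ such that $$\mathrm{diag}\bigl(P[xx^\top]-l_kP[x]^\top-P[x]u_k^\top+l_ku_k^\top\bigr)\le0,\qquad \mathrm{diag}\bigl(P[yy^\top]-l_{k+1}P[y]^\top-P[y]u_{k+1}^\top+l_{k+1}u_{k+1}^\top\bigr)\le0,$$ $$P[y]\ge0,\qquad P[y]\ge w_kP[x]+b_k,\qquad \mathrm{diag}(w_kP[xy^\top])+P[y]\odot b_k=\mathrm{diag}(P[yy^\top]).$$ Write $g_{\mathrm{SDP}}(\lambda)=\sum_{k=0}^{K-1}s_k(\lambda)+\max_{x\in\mathcal X_K}(c-q_K)^\top x$. **SDP relaxation of the whole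 network (Raghunathan et al., 2018).** It uses a single symmetric matrix $P\succeq0$ indexed by the constant $1$ and all coordinates of $x_0,\dots,x_K$, with $P[1]=1$: maximize $c^\top P[x_K]$ subject to $$\mathrm{diag}\bigl(P[x_kx_k^\top]-l_kP[x_k]^\top-P[x_k]u_k^\top+l_ku_k^\top\bigr)\le0\quad(0\le k\le K),\qquad l_K\le P[x_K]\le u_K,$$ and, for $0\le k\le K-1$, $$P[x_{k+1}]\ge0,\quad P[x_{k+1}]\ge w_kP[x_k]+b_k,\quad \mathrm{diag}(w_kP[x_kx_{k+1}^\top])+P[x_{k+1}]\odot b_k=\mathrm{diag}(P[x_{k+1}x_{k+1}^\top]).$$ Its Lagrangian dual is obtained by introducing a multiplier for every equality, a nonnegative multiplier for every scalar inequality, and a positive semidefinite matrix multiplier for $P\succeq0$, taking the supremum of the Lagrangian over all symmetric $P$, and minimizing (taking the infimum) over the multipliers. **Proposition (Quadratic Multipliers).** For every such $\lambda$ and every $0\le k\le K-1$, $s_k(\lambda)$ is an upper bound on the $k$-th inner maximum, so that $g(\lambda)\le g_{\mathrm{SDP}}(\lambda)$. Moreover, the optimal value $$\inf_{q_1,\dots,q_K,\;Q_1,\dots,Q_{K-1}}g_{\mathrm{SDP}}(\lambda)$$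 of the functional Lagrangian dual with SDP-relaxed inner problems equals the optimal value of the Lagrangian dual of the SDP relaxation of the whole network, and both equal the optimal value of that SDP relaxation itself. -/

import Mathlib

open scoped Matrix

namespace FunLag

noncomputable section

/-! ## Semidefinite programs and their Lagrangian duals -/

/-- Optimal value of the semidefinite program
`max obj P` subject to `P ⪰ 0`, `ineq i P ≥ 0` for all `i`, `eqn j P = 0` for all `j`
(`⊥` if it is infeasible). -/
def sdpPrimal {ι I J : Type} [Fintype ι]
    (obj : Matrix ι ι ℝ → ℝ) (ineq : I → Matrix ι ι ℝ → ℝ) (eqn : J → Matrix ι ι ℝ → ℝ) :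
    EReal :=
  ⨆ P ∈ {P : Matrix ι ι ℝ | P.PosSemidef ∧ (∀ i, 0 ≤ ineq i P) ∧ ∀ j, eqn j P = 0},
    ((obj P : ℝ) : EReal)

/-- The Lagrangian of that program, with multipliers `μ` for the inequalities, `ν` for the
equations and `S` for the constraint `P ⪰ 0`. -/
def sdpLagrangian {ι I J : Type} [Fintype ι] [Fintype I] [Fintype J]
    (obj : Matrix ι ι ℝ → ℝ) (ineq : I → Matrix ι ι ℝ → ℝ) (eqn : J → Matrix ι ι ℝ → ℝ)
    (μ : I → ℝ) (ν : J → ℝ) (S P : Matrix ι ι ℝ) : ℝ :=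
  obj P + ∑ i, μ i * ineq i P + ∑ j, ν j * eqn j P + (S * P).trace

/-- Optimal value of the Lagrangian dual: the infimum over `μ ≥ 0`, `ν` and `S ⪰ 0` of the
supremum of the Lagrangian over all symmetric matrices `P`. -/
def sdpDual {ι I J : Type} [Fintype ι] [Fintype I] [Fintype J]
    (obj : Matrix ι ι ℝ → ℝ) (ineq : I → Matrix ι ι ℝ → ℝ) (eqn : J → Matrix ι ι ℝ → ℝ) :
    EReal :=
  ⨅ (μ : I → ℝ) (_ : 0 ≤ μ) (ν : J → ℝ) (S : Matrix ι ι ℝ) (_ : S.PosSemidef),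
    ⨆ P ∈ {P : Matrix ι ι ℝ | P.IsSymm}, ((sdpLagrangian obj ineq eqn μ ν S P : ℝ) : EReal)

/-! ## The verification problem -/

/-- The data of a verification problem for a deterministic ReLU network with `K` layers:
widths `n k` of the activations `x_0, …, x_K`, weights and biases of the layers
`x_k ↦ x_{k+1} = ReLU (w_k x_k + b_k)`, the activation boxes `[l_k, u_k]`, and the linear
specification `ψ x_K = cᵀ x_K`. -/
structure Problem (K : ℕ) where
  n : Fin (K + 1) → ℕ
  w : ∀ k : Fin K, Matrix (Fin (n k.succ)) (Fin (n k.castSucc)) ℝ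
  b : ∀ k : Fin K, Fin (n k.succ) → ℝ
  l : ∀ k : Fin (K + 1), Fin (n k) → ℝ
  u : ∀ k : Fin (K + 1), Fin (n k) → ℝ
  c : Fin (n (Fin.last K)) → ℝ

namespace Problem

variable {K : ℕ} (p : Problem K)

/-- The space `ℝ^{n_k}` of activations. -/
abbrev Act (k : Fin (K + 1)) : Type := Fin (p.n k) → ℝ

/-- The box `𝒳_k = [l_k, u_k]`. -/
def box (k : Fin (K + 1)) : Set (p.Act k) := Set.Icc (p.l k) (p.u k)

/-- The layer `π_k x = ReLU (w_k x + b_k)`. -/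
def layer (k : Fin K) (x : p.Act k.castSucc) : p.Act k.succ :=
  fun i => max ((p.w k *ᵥ x + p.b k) i) 0

/-- The boxes are valid activation bounds: `l_0 ≤ u_0`, and each layer maps `𝒳_k` into
`𝒳_{k+1}`. -/
structure ValidBounds : Prop where
  input : p.l 0 ≤ p.u 0
  layer_mem : ∀ (k : Fin K), ∀ x ∈ p.box k.castSucc, p.layer k x ∈ p.box k.succ

/-! ## The functional Lagrangian dual function -/

/-- The inner maximum `max_{x ∈ 𝒳_k} g_k (x, λ_k, λ_{k+1})`, `0 ≤ k ≤ K - 1`, where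
`g_k (x, λ_k, λ_{k+1}) = λ_{k+1} (π_k x) - λ_k x`; for `k = 0` it is used with `λ_0 = 0`. -/
def innerMax (lam : ∀ k, p.Act k → ℝ) (k : Fin K) : EReal :=
  ⨆ x ∈ p.box k.castSucc, ((lam k.succ (p.layer k x) - lam k.castSucc x : ℝ) : EReal)

/-- The last maximum `max_{x ∈ 𝒳_K} cᵀ x - λ_K x`. -/
def finalMax (lam : ∀ k, p.Act k → ℝ) : EReal :=
  ⨆ x ∈ p.box (Fin.last K), ((p.c ⬝ᵥ x - lam (Fin.last K) x : ℝ) : EReal)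

/-- The functional Lagrangian dual function, with all maxima exact. -/
def dualFun (lam : ∀ k, p.Act k → ℝ) : EReal :=
  ∑ k : Fin K, p.innerMax lam k + p.finalMax lam

/-! ## Quadratic multipliers -/

/-- Multipliers `λ_k x = q_kᵀ x + ½ xᵀ Q_k x` (`Q_k` symmetric), with the convention `λ_0 = 0`
and with a linear last multiplier `λ_K x = q_Kᵀ x`. -/
structure QuadMult where
  q : ∀ k : Fin (K + 1), Fin (p.n k) → ℝ
  Q : ∀ k : Fin (K + 1), Matrix (Fin (p.n k)) (Fin (p.n k)) ℝ
  symm : ∀ k, (Q k).IsSymm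
  q_zero : q 0 = 0
  Q_zero : Q 0 = 0
  Q_last : Q (Fin.last K) = 0

/-- The functions `λ_k`. -/
def QuadMult.toFun {p : Problem K} (L : p.QuadMult) (k : Fin (K + 1)) (x : p.Act k) : ℝ :=
  L.q k ⬝ᵥ x + (1 / 2) * (x ⬝ᵥ (L.Q k *ᵥ x))

/-! ## The two-layer SDP relaxation of the inner problems -/

/-- Index set of the two-layer matrix: `none` stands for the constant `1`, `some (inl i)` for
`y_i` (output of layer `k`), `some (inr j)` for `x_j` (input of layer `k`). So `P none (some a)`
is `P[a]` and `P (some a) (some a')` is `P[a a']`. -/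
abbrev Idx₂ (k : Fin K) : Type := Option (Fin (p.n k.succ) ⊕ Fin (p.n k.castSucc))

/-- The feasible set `Δ_k` of the two-layer SDP relaxation. -/
structure TwoLayerFeasible (k : Fin K) (P : Matrix (p.Idx₂ k) (p.Idx₂ k) ℝ) : Prop where
  psd : P.PosSemidef
  one : P none none = 1
  box_x : ∀ j, P (some (.inr j)) (some (.inr j)) - p.l k.castSucc j * P none (some (.inr j))
    - P none (some (.inr j)) * p.u k.castSucc j + p.l k.castSucc j * p.u k.castSucc j ≤ 0
  box_y : ∀ i, P (some (.inl i)) (some (.inl i)) - p.l k.succ i * P none (some (.inl i))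
    - P none (some (.inl i)) * p.u k.succ i + p.l k.succ i * p.u k.succ i ≤ 0
  nonneg : ∀ i, 0 ≤ P none (some (.inl i))
  ge_affine : ∀ i,
    ∑ j, p.w k i j * P none (some (.inr j)) + p.b k i ≤ P none (some (.inl i))
  compl : ∀ i, ∑ j, p.w k i j * P (some (.inr j)) (some (.inl i))
    + P none (some (.inl i)) * p.b k i = P (some (.inl i)) (some (.inl i))

/-- The objective `q_{k+1}ᵀ P[y] + ½ Tr (Q_{k+1} P[yyᵀ]) - q_kᵀ P[x] - ½ Tr (Q_k P[xxᵀ])`. -/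
def twoLayerObj (L : p.QuadMult) (k : Fin K) (P : Matrix (p.Idx₂ k) (p.Idx₂ k) ℝ) : ℝ :=
  L.q k.succ ⬝ᵥ (fun i => P none (some (.inl i)))
    + (1 / 2) * (L.Q k.succ * P.submatrix (fun i => some (.inl i)) (fun i => some (.inl i))).trace
    - L.q k.castSucc ⬝ᵥ (fun j => P none (some (.inr j)))
    - (1 / 2)
      * (L.Q k.castSucc * P.submatrix (fun j => some (.inr j)) (fun j => some (.inr j))).trace

/-- Optimal value of the two-layer SDP relaxation of the `k`-th inner problem. -/
def innerSDP (L : p.QuadMult) (k : Fin K) : EReal :=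
  ⨆ P ∈ {P | p.TwoLayerFeasible k P}, ((p.twoLayerObj L k P : ℝ) : EReal)

/-- The functional Lagrangian dual function with the inner maxima `k = 0, …, K - 1` replaced by
their two-layer SDP relaxations. The last problem is a linear program over a box. -/
def dualFunSDP (L : p.QuadMult) : EReal :=
  ∑ k : Fin K, p.innerSDP L k + p.finalMax L.toFun

/-- Optimal value of the functional Lagrangian dual over quadratic multipliers. -/
def flDualValue : EReal := ⨅ L : p.QuadMult, p.dualFunSDP L

/-! ## The SDP relaxation of the whole network, with a single moment matrix -/

/-- The scalar activations `x_{k,i}` of all layers `0, …, K`. -/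
abbrev Var : Type := Σ k : Fin (K + 1), Fin (p.n k)

/-- The scalar activations `x_{k+1,i}` computed by the layers `k = 0, …, K - 1`. -/
abbrev Unit₁ : Type := Σ k : Fin K, Fin (p.n k.succ)

/-- Index set of the moment matrix of the whole network; `none` stands for the constant `1`. -/
abbrev Idx : Type := Option p.Var

/-- The moment `P[x_{k,i}]`. -/
def mom₁ (P : Matrix p.Idx p.Idx ℝ) (k : Fin (K + 1)) (i : Fin (p.n k)) : ℝ :=
  P none (some ⟨k, i⟩)

/-- The moment `P[x_{k,i} x_{m,j}]`. -/
def mom₂ (P : Matrix p.Idx p.Idx ℝ) (k : Fin (K + 1)) (i : Fin (p.n k))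
    (m : Fin (K + 1)) (j : Fin (p.n m)) : ℝ :=
  P (some ⟨k, i⟩) (some ⟨m, j⟩)

/-- The objective `cᵀ P[x_K]`. -/
def netObj (P : Matrix p.Idx p.Idx ℝ) : ℝ := p.c ⬝ᵥ p.mom₁ P (Fin.last K)

/-- `-diag (P[x_k x_kᵀ] - l_k P[x_k]ᵀ - P[x_k] u_kᵀ + l_k u_kᵀ)`. -/
def netBox (a : p.Var) (P : Matrix p.Idx p.Idx ℝ) : ℝ :=
  -(p.mom₂ P a.1 a.2 a.1 a.2 - p.l a.1 a.2 * p.mom₁ P a.1 a.2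
    - p.mom₁ P a.1 a.2 * p.u a.1 a.2 + p.l a.1 a.2 * p.u a.1 a.2)

/-- `P[x_{k+1}]`. -/
def netNonneg (a : p.Unit₁) (P : Matrix p.Idx p.Idx ℝ) : ℝ := p.mom₁ P a.1.succ a.2

/-- `P[x_{k+1}] - w_k P[x_k] - b_k`. -/
def netGeAffine (a : p.Unit₁) (P : Matrix p.Idx p.Idx ℝ) : ℝ :=
  p.mom₁ P a.1.succ a.2 - (∑ j, p.w a.1 a.2 j * p.mom₁ P a.1.castSucc j + p.b a.1 a.2)

/-- `P[x_K] - l_K`. -/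
def netLower (i : Fin (p.n (Fin.last K))) (P : Matrix p.Idx p.Idx ℝ) : ℝ :=
  p.mom₁ P (Fin.last K) i - p.l (Fin.last K) i

/-- `u_K - P[x_K]`. -/
def netUpper (i : Fin (p.n (Fin.last K))) (P : Matrix p.Idx p.Idx ℝ) : ℝ :=
  p.u (Fin.last K) i - p.mom₁ P (Fin.last K) i

/-- `diag (w_k P[x_k x_{k+1}ᵀ]) + P[x_{k+1}] ⊙ b_k - diag (P[x_{k+1} x_{k+1}ᵀ])`. -/
def netCompl (a : p.Unit₁) (P : Matrix p.Idx p.Idx ℝ) : ℝ :=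
  ∑ j, p.w a.1 a.2 j * p.mom₂ P a.1.castSucc j a.1.succ a.2
    + p.mom₁ P a.1.succ a.2 * p.b a.1 a.2 - p.mom₂ P a.1.succ a.2 a.1.succ a.2

/-- Index set of the inequality constraints. -/
abbrev IneqIdx : Type :=
  p.Var ⊕ p.Unit₁ ⊕ p.Unit₁ ⊕ Fin (p.n (Fin.last K)) ⊕ Fin (p.n (Fin.last K))

/-- The inequality constraints (each required to be `≥ 0`). -/
def netIneq : p.IneqIdx → Matrix p.Idx p.Idx ℝ → ℝ :=
  Sum.elim p.netBox (Sum.elim p.netNonneg (Sum.elim p.netGeAffine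
    (Sum.elim p.netLower p.netUpper)))

/-- The equality constraints (each required to be `= 0`); the first one is `P[1] = 1`. -/
def netEq : Option p.Unit₁ → Matrix p.Idx p.Idx ℝ → ℝ
  | none, P => P none none - 1
  | some a, P => p.netCompl a P

/-- Optimal value of the SDP relaxation of the whole network. -/
def netSDP : EReal := sdpPrimal p.netObj p.netIneq p.netEq

/-- Optimal value of the Lagrangian dual of the SDP relaxation of the whole network. -/
def netSDPDual : EReal := sdpDual p.netObj p.netIneq p.netEq

end Problem

end

end FunLag

/-!
The functional Lagrangian with SDP-relaxed inner problems is itself a Lagrangian dual. Let the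
network relaxation be split into independent two-layer matrices `P_k ∈ Δ_k` and a point `x` of the
last box, tied together by the equations "`P_k` and `P_{k+1}` have the same first and second moments
of the layer they share" and "`x` is the vector of first moments of the last output". Then `q_k` and
`Q_k` are exactly the multipliers of these equations, and the dual function splits as a sum because
the remaining constraints are separate (`sum_twoLayerObj_multOf`). Weak duality is a telescoping sum
(`netSDP_le_dualFunSDP`).

For strong duality no constraint qualification is available: with `l = u`, for instance, there is no
strictly feasible point. Compactness takes its place. The sets `Δ_k` are compact, since the box
constraints bound the diagonal, and for affine constraints on a compact convex set the separation of
the image from a closed cone yields multipliers with an arbitrarily small gap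
(`exists_multipliers`). What remains is that every consistent family `P_k` comes from one positive
semidefinite matrix of the whole network, a positive semidefinite completion along a chain: Gram
vectors are chosen layer by layer and matched by isometries (`exists_chain_gram`).

For the Lagrangian dual of the network relaxation the same separation is applied on
`{P ⪰ 0, tr P ≤ R}`. Maximizing an affine function over this set produces one more nonnegative
multiplier, for `tr P ≤ R`, and a positive semidefinite one for `P ⪰ 0`. The trace bound is itself a
combination of the constraints, because the box constraints bound second moments, so its multiplier
is redistributed over them (`sdpDual_le_sdpPrimal`).
-/

namespace FunLag

noncomputable section

/-! ### Separation and multipliers -/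

/-- Lagrange multipliers for a compact convex set `A` of triples (objective value, values of the
inequality constraints, values of the equality constraints): if no triple of `A` is feasible with
objective value at least `t`, then some multipliers bound the Lagrangian by `t` on all of `A`.
Compactness replaces a constraint qualification. -/
theorem exists_multipliers_of_isCompact {I J : Type*} [Fintype I] [Fintype J]
    {A : Set (ℝ × (I → ℝ) × (J → ℝ))} (hA : IsCompact A) (hA' : Convex ℝ A) (t : ℝ)
    (h : ∀ a ∈ A, 0 ≤ a.2.1 → a.2.2 = 0 → a.1 < t) :
    ∃ (μ : I → ℝ) (ν : J → ℝ), 0 ≤ μ ∧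
      ∀ a ∈ A, a.1 + ∑ i, μ i * a.2.1 i + ∑ j, ν j * a.2.2 j < t := by
  classical
  set B : Set (ℝ × (I → ℝ) × (J → ℝ)) := Set.Ici t ×ˢ (Set.Ici 0 ×ˢ {0}) with hB
  have hBc : IsClosed B := isClosed_Ici.prod (isClosed_Ici.prod isClosed_singleton)
  have hBv : Convex ℝ B := (convex_Ici t).prod ((convex_Ici 0).prod (convex_singleton 0))
  have hdisj : Disjoint A B := by
    rw [Set.disjoint_left]
    rintro a haA ⟨h1, h2, h3⟩
    exact absurd (h a haA h2 h3) (not_lt.2 h1)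
  obtain ⟨φ, u, v, hu, huv, hv⟩ := geometric_hahn_banach_compact_closed hA' hA hBv hBc hdisj
  set α : ℝ := φ (1, 0, 0) with hα
  set μ : I → ℝ := fun i => φ (0, Pi.single i 1, 0) with hμ
  set ν : J → ℝ := fun j => φ (0, 0, Pi.single j 1) with hν
  have hφ : ∀ a : ℝ × (I → ℝ) × (J → ℝ),
      φ a = a.1 * α + ∑ i, a.2.1 i * μ i + ∑ j, a.2.2 j * ν j := by
    rintro ⟨r, x, y⟩
    have : ((r, x, y) : ℝ × (I → ℝ) × (J → ℝ)) = r • (1, 0, 0) +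
        ∑ i, x i • ((0, Pi.single i 1, 0) : ℝ × (I → ℝ) × (J → ℝ)) +
        ∑ j, y j • ((0, 0, Pi.single j 1) : ℝ × (I → ℝ) × (J → ℝ)) := by
      refine Prod.ext ?_ (Prod.ext ?_ ?_)
      · simp [Prod.fst_sum]
      · ext k; simp [Prod.fst_sum, Prod.snd_sum, Pi.single_apply]
      · ext k; simp [Prod.snd_sum, Pi.single_apply]
    conv_lhs => rw [this]
    simp only [map_add, map_sum, map_smul, smul_eq_mul, hα, hμ, hν]
  -- A linear functional bounded below on the cone directions of `B` is nonnegative on them.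
  have hray : ∀ d : ℝ × (I → ℝ) × (J → ℝ), 0 ≤ d.1 → 0 ≤ d.2.1 → d.2.2 = 0 → 0 ≤ φ d := by
    intro d h1 h2 h3
    by_contra! hneg
    have hmem : ∀ s : ℝ, 0 ≤ s → (t, (0 : I → ℝ), (0 : J → ℝ)) + s • d ∈ B := by
      intro s hs
      refine ⟨?_, ?_, ?_⟩
      · simpa using mul_nonneg hs h1
      · simpa using smul_nonneg hs h2
      · simp [h3]
    have hs0 : 0 ≤ |φ (t, (0 : I → ℝ), (0 : J → ℝ)) - v| / -φ d :=
      div_nonneg (abs_nonneg _) (by linarith)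
    have := hv _ (hmem _ hs0)
    rw [map_add, map_smul, smul_eq_mul, div_mul_eq_mul_div, mul_comm, div_neg, mul_div_assoc] at this
    rw [mul_comm, div_mul_cancel₀ _ hneg.ne] at this
    linarith [le_abs_self (φ (t, (0 : I → ℝ), (0 : J → ℝ)) - v)]
  have hα0 : 0 ≤ α := hray _ zero_le_one le_rfl rfl
  have hμ0 : 0 ≤ μ := fun i => hray _ le_rfl (by simp) rfl
  have htB : v < t * α := by
    have := hv (t, 0, 0) ⟨Set.self_mem_Ici, Set.self_mem_Ici, rfl⟩
    simpa [hφ] using this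
  rcases hα0.eq_or_lt with h0 | hpos
  · -- The separating hyperplane is vertical: the constraints alone are inconsistent on `A`, with
    -- a uniform margin, and a large multiple of them beats the objective.
    rw [← h0, mul_zero] at htB
    obtain ⟨C, hC⟩ := (hA.image continuous_fst).bddAbove
    set M : ℝ := max 0 ((C - t + 1) / (-u))
    have hu0 : 0 < -u := by linarith
    refine ⟨fun i => M * μ i, fun j => M * ν j, fun i => mul_nonneg (le_max_left _ _) (hμ0 i), ?_⟩
    intro a ha
    have h1 := hu a ha
    rw [hφ, ← h0, mul_zero, zero_add] at h1
    have h2 : a.1 ≤ C := hC ⟨a, ha, rfl⟩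
    have h3 : C - t + 1 ≤ M * (-u) := (div_le_iff₀ hu0).1 (le_max_right _ _)
    have h4 : M * (∑ i, a.2.1 i * μ i + ∑ j, a.2.2 j * ν j) ≤ M * u :=
      mul_le_mul_of_nonneg_left h1.le (le_max_left _ _)
    have h5 : ∑ i, M * μ i * a.2.1 i + ∑ j, M * ν j * a.2.2 j
        = M * (∑ i, a.2.1 i * μ i + ∑ j, a.2.2 j * ν j) := by
      rw [mul_add, Finset.mul_sum, Finset.mul_sum]
      congr 1 <;> exact Finset.sum_congr rfl fun _ _ => by ring
    rw [add_assoc, h5]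
    linarith
  · refine ⟨fun i => μ i / α, fun j => ν j / α, fun i => div_nonneg (hμ0 i) hα0, ?_⟩
    intro a ha
    have h1 := hu a ha
    rw [hφ] at h1
    have h5 : a.1 + ∑ i, μ i / α * a.2.1 i + ∑ j, ν j / α * a.2.2 j
        = (a.1 * α + ∑ i, a.2.1 i * μ i + ∑ j, a.2.2 j * ν j) / α := by
      rw [add_div, add_div, mul_div_cancel_right₀ _ hpos.ne', Finset.sum_div, Finset.sum_div]
      congr 1
      · congr 1; exact Finset.sum_congr rfl fun _ _ => by ring
      · exact Finset.sum_congr rfl fun _ _ => by ring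
    rw [h5, div_lt_iff₀ hpos]
    linarith

/-- `f` is the function underlying an affine map. -/
def IsAff {E : Type*} [AddCommGroup E] [Module ℝ E] (f : E → ℝ) : Prop :=
  ∃ F : E →ᵃ[ℝ] ℝ, ∀ x, F x = f x

namespace IsAff

variable {E : Type*} [AddCommGroup E] [Module ℝ E] {f g : E → ℝ}

theorem of_isLinearMap (h : IsLinearMap ℝ f) : IsAff f := ⟨h.mk'.toAffineMap, fun _ => rfl⟩

theorem const (c : ℝ) : IsAff fun _ : E => c := ⟨AffineMap.const ℝ E c, fun _ => rfl⟩

theorem add (hf : IsAff f) (hg : IsAff g) : IsAff fun x => f x + g x := by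
  obtain ⟨F, hF⟩ := hf
  obtain ⟨G, hG⟩ := hg
  exact ⟨F + G, fun x => by simp [hF, hG]⟩

theorem const_mul (c : ℝ) (hf : IsAff f) : IsAff fun x => c * f x := by
  obtain ⟨F, hF⟩ := hf
  exact ⟨c • F, fun x => by simp [hF]⟩

theorem mul_const (hf : IsAff f) (c : ℝ) : IsAff fun x => f x * c := by
  simpa only [mul_comm] using hf.const_mul c

theorem neg (hf : IsAff f) : IsAff fun x => -f x := by
  simpa using hf.const_mul (-1)

theorem sub (hf : IsAff f) (hg : IsAff g) : IsAff fun x => f x - g x := by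
  simpa only [sub_eq_add_neg] using hf.add hg.neg

theorem sum {ι : Type*} (s : Finset ι) {f : ι → E → ℝ} (h : ∀ i ∈ s, IsAff (f i)) :
    IsAff fun x => ∑ i ∈ s, f i x := by
  classical
  induction s using Finset.induction_on with
  | empty => simpa using const 0
  | insert a s ha ih =>
    simp only [Finset.sum_insert ha]
    exact (h a (by simp)).add (ih fun i hi => h i (by simp [hi]))

theorem convex_le (hf : IsAff f) : Convex ℝ {x | f x ≤ 0} := by
  obtain ⟨F, hF⟩ := hf
  simpa [Set.preimage, hF] using (convex_Iic (0 : ℝ)).affine_preimage F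

theorem convex_eq (hf : IsAff f) : Convex ℝ {x | f x = 0} := by
  obtain ⟨F, hF⟩ := hf
  simpa [Set.preimage, hF] using (convex_singleton (0 : ℝ)).affine_preimage F

variable [TopologicalSpace E] [IsTopologicalAddGroup E] [ContinuousSMul ℝ E] [T2Space E]
  [FiniteDimensional ℝ E]

theorem continuous (hf : IsAff f) : Continuous f := by
  obtain ⟨F, hF⟩ := hf
  rw [← funext hF, AffineMap.decomp F]
  exact F.linear.continuous_of_finiteDimensional.add continuous_const

theorem isClosed_le (hf : IsAff f) : IsClosed {x | f x ≤ 0} :=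
  _root_.isClosed_le hf.continuous continuous_const

theorem isClosed_eq (hf : IsAff f) : IsClosed {x | f x = 0} :=
  _root_.isClosed_eq hf.continuous continuous_const

end IsAff

/-- Lagrange multipliers for the maximization of an affine function over a compact convex set
subject to finitely many affine constraints. -/
theorem exists_multipliers {E I J : Type*} [Fintype I] [Fintype J] [AddCommGroup E] [Module ℝ E]
    [TopologicalSpace E] [IsTopologicalAddGroup E] [ContinuousSMul ℝ E] [T2Space E]
    [FiniteDimensional ℝ E] {D : Set E} (hD : IsCompact D) (hD' : Convex ℝ D)
    {f : E → ℝ} {g : I → E → ℝ} {h : J → E → ℝ} (hf : IsAff f) (hg : ∀ i, IsAff (g i))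
    (hh : ∀ j, IsAff (h j)) (t : ℝ)
    (H : ∀ x ∈ D, (∀ i, 0 ≤ g i x) → (∀ j, h j x = 0) → f x < t) :
    ∃ (μ : I → ℝ) (ν : J → ℝ), 0 ≤ μ ∧
      ∀ x ∈ D, f x + ∑ i, μ i * g i x + ∑ j, ν j * h j x < t := by
  have hfc := hf.continuous
  have hgc := fun i => (hg i).continuous
  have hhc := fun j => (hh j).continuous
  obtain ⟨F, hF⟩ := hf
  choose G hG using hg
  choose H' hH' using hh
  let Φ : E →ᵃ[ℝ] ℝ × (I → ℝ) × (J → ℝ) := F.prod ((AffineMap.pi G).prod (AffineMap.pi H'))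
  have hΦ : ∀ x, Φ x = (f x, (fun i => g i x), fun j => h j x) := fun x =>
    Prod.ext (hF x) (Prod.ext (funext fun i => hG i x) (funext fun j => hH' j x))
  have hΦc : Continuous Φ := by
    rw [show ⇑Φ = _ from funext hΦ]
    fun_prop
  obtain ⟨μ, ν, hμ, hl⟩ := exists_multipliers_of_isCompact (hD.image hΦc) (hD'.affine_image Φ) t (by
    rintro _ ⟨x, hx, rfl⟩ h1 h2
    rw [hΦ] at h1 h2 ⊢
    exact H x hx h1 (congrFun h2))
  refine ⟨μ, ν, hμ, fun x hx => ?_⟩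
  have := hl _ ⟨x, hx, rfl⟩
  rwa [hΦ] at this

/-! ### Duality for semidefinite programs -/

section SDP

variable {ι : Type}

theorem isAff_entry (a b : ι) : IsAff fun P : Matrix ι ι ℝ => P a b :=
  .of_isLinearMap ⟨fun _ _ => rfl, fun _ _ => rfl⟩

theorem convex_posSemidef : Convex ℝ {P : Matrix ι ι ℝ | P.PosSemidef} :=
  fun _ hP _ hQ _ _ ha hb _ => (hP.smul ha).add (hQ.smul hb)

variable [Fintype ι]

theorem trace_vecMulVec_mul (v : ι → ℝ) (P : Matrix ι ι ℝ) :
    (Matrix.vecMulVec v v * P).trace = v ⬝ᵥ (P *ᵥ v) := by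
  rw [Matrix.vecMulVec_mul, Matrix.trace_vecMulVec, dotProduct_comm, ← Matrix.dotProduct_mulVec]

theorem posSemidef_vecMulVec_self (v : ι → ℝ) : (Matrix.vecMulVec v v).PosSemidef := by
  simpa using Matrix.posSemidef_vecMulVec_self_star v

theorem posSemidef_iff_real {P : Matrix ι ι ℝ} :
    P.PosSemidef ↔ P.IsSymm ∧ ∀ v, 0 ≤ v ⬝ᵥ (P *ᵥ v) := by
  rw [Matrix.posSemidef_iff_dotProduct_mulVec]
  simp [Matrix.IsHermitian, Matrix.IsSymm, Matrix.conjTranspose_eq_transpose_of_trivial]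

theorem isClosed_posSemidef : IsClosed {P : Matrix ι ι ℝ | P.PosSemidef} := by
  simp only [posSemidef_iff_real, Set.ofPred_and, Set.ofPred_forall, Matrix.IsSymm]
  refine (isClosed_eq (by fun_prop) continuous_id).inter (isClosed_iInter fun v => ?_)
  exact isClosed_le continuous_const (by fun_prop)

/-- A pairing of positive semidefinite matrices is nonnegative. -/
theorem trace_mul_nonneg {S P : Matrix ι ι ℝ} (hS : S.PosSemidef) (hP : P.PosSemidef) :
    0 ≤ (S * P).trace := by
  obtain ⟨m, A, hA⟩ := Matrix.posSemidef_iff_eq_sum_vecMulVec.mp hS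
  rw [hA, Finset.sum_mul, Matrix.trace_sum]
  refine Finset.sum_nonneg fun i _ => ?_
  rw [star_trivial, trace_vecMulVec_mul]
  exact (posSemidef_iff_real.1 hP).2 _

theorem two_mul_abs_entry_le {P : Matrix ι ι ℝ} (hP : P.PosSemidef) (a b : ι) :
    2 * |P a b| ≤ P a a + P b b := by
  classical
  obtain ⟨hs, hq⟩ := posSemidef_iff_real.1 hP
  have h1 := hq (Pi.single a 1 + Pi.single b 1)
  have h2 := hq (Pi.single a 1 - Pi.single b 1)
  have hab : P b a = P a b := hs.apply a b
  simp [Matrix.mulVec_add, Matrix.mulVec_sub, add_dotProduct, sub_dotProduct, hab] at h1 h2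
  have : |P a b| ≤ (P a a + P b b) / 2 := abs_le.2 ⟨by linarith, by linarith⟩
  linarith

/-- A closed set of positive semidefinite matrices with bounded diagonals is compact. -/
theorem isCompact_of_posSemidef {D : Set (Matrix ι ι ℝ)} (hD : IsClosed D)
    (hpsd : ∀ P ∈ D, P.PosSemidef) (C : ℝ) (hC : ∀ P ∈ D, ∀ a, P a a ≤ C) : IsCompact D := by
  have hK : IsCompact (Set.univ.pi fun _ => Set.univ.pi fun _ => Set.Icc (-C) C :
      Set (ι → ι → ℝ)) := isCompact_univ_pi fun _ => isCompact_univ_pi fun _ => isCompact_Icc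
  refine IsCompact.of_isClosed_subset hK hD fun P hP a _ b _ => ?_
  have h := two_mul_abs_entry_le (hpsd P hP) a b
  have h1 := hC P hP a
  have h2 := hC P hP b
  exact abs_le.1 (by linarith)

variable {I J : Type} [Fintype I] [Fintype J] {obj : Matrix ι ι ℝ → ℝ}
  {ineq : I → Matrix ι ι ℝ → ℝ} {eqn : J → Matrix ι ι ℝ → ℝ}

/-- Weak duality. -/
theorem sdpPrimal_le_sdpDual : sdpPrimal obj ineq eqn ≤ sdpDual obj ineq eqn := by
  unfold sdpPrimal sdpDual
  refine iSup₂_le fun P hP => ?_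
  obtain ⟨hpsd, hi, he⟩ := hP
  refine le_iInf₂ fun μ hμ => le_iInf₂ fun ν S => le_iInf fun hS => ?_
  refine le_iSup₂_of_le P (posSemidef_iff_real.1 hpsd).1 (EReal.coe_le_coe_iff.2 ?_)
  have h1 : 0 ≤ ∑ i, μ i * ineq i P := Finset.sum_nonneg fun i _ => mul_nonneg (hμ i) (hi i)
  have h2 : ∑ j, ν j * eqn j P = 0 := Finset.sum_eq_zero fun j _ => by rw [he j, mul_zero]
  have h3 := trace_mul_nonneg hS hpsd
  unfold sdpLagrangian
  linarith

/-- On symmetric matrices an affine function is a pairing with a symmetric matrix, plus a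
constant. -/
theorem IsAff.exists_symm {f : Matrix ι ι ℝ → ℝ} (hf : IsAff f) :
    ∃ H : Matrix ι ι ℝ, H.IsSymm ∧ ∀ P : Matrix ι ι ℝ, P.IsSymm → f P = (H * P).trace + f 0 := by
  classical
  obtain ⟨F, hF⟩ := hf
  set h : Matrix ι ι ℝ := fun i j => F.linear (Matrix.single i j 1) with hh
  have hlin : ∀ P : Matrix ι ι ℝ, F.linear P = ∑ i, ∑ j, P i j * h i j := by
    intro P
    conv_lhs => rw [Matrix.matrix_eq_sum_single P]
    simp only [map_sum]
    refine Finset.sum_congr rfl fun i _ => Finset.sum_congr rfl fun j _ => ?_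
    rw [hh, ← smul_eq_mul, ← map_smul, Matrix.smul_single, smul_eq_mul, mul_one]
  refine ⟨(1 / 2 : ℝ) • (h + hᵀ), ?_, fun P hP => ?_⟩
  · simp [Matrix.IsSymm, add_comm]
  · have h1 : f P = F.linear P + f 0 := by
      rw [← hF, ← hF, AffineMap.decomp']
      simp
    rw [h1, hlin]
    congr 1
    have h2 : (hᵀ * P).trace = ∑ i, ∑ j, P i j * h i j := by
      rw [Finset.sum_comm]
      simp [Matrix.trace, Matrix.mul_apply, mul_comm]
    have h3 : (h * P).trace = (hᵀ * P).trace := by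
      rw [← Matrix.trace_transpose, Matrix.transpose_mul, hP.eq, Matrix.trace_mul_comm]
    rw [smul_mul_assoc, Matrix.trace_smul, add_mul, Matrix.trace_add, h3, h2, smul_eq_mul]
    ring

/-- Strong duality for a semidefinite program whose constraints certify a bound `R` on the trace
through multipliers `μ₀`, `ν₀`, `S₀`. No feasible interior point is needed. -/
theorem sdpDual_le_sdpPrimal (hobj : IsAff obj) (hineq : ∀ i, IsAff (ineq i))
    (heqn : ∀ j, IsAff (eqn j)) {R : ℝ} (hR : 0 < R) {μ₀ : I → ℝ} {ν₀ : J → ℝ}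
    {S₀ : Matrix ι ι ℝ} (hμ₀ : 0 ≤ μ₀) (hS₀ : S₀.PosSemidef)
    (hcert : ∀ P : Matrix ι ι ℝ, P.IsSymm →
      R - P.trace = ∑ i, μ₀ i * ineq i P + ∑ j, ν₀ j * eqn j P + (S₀ * P).trace) :
    sdpDual obj ineq eqn ≤ sdpPrimal obj ineq eqn := by
  classical
  by_contra! hlt
  obtain ⟨t, ht1, ht2⟩ := EReal.lt_iff_exists_real_btwn.1 hlt
  refine absurd ht2 (not_lt.2 ?_)
  set D : Set (Matrix ι ι ℝ) := {P | P.PosSemidef} ∩ {P | P.trace ≤ R} with hDdef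
  have hDc : IsCompact D := by
    refine isCompact_of_posSemidef (isClosed_posSemidef.inter
      (isClosed_le (by fun_prop) continuous_const)) (fun P hP => hP.1) R fun P hP a => ?_
    exact (Finset.single_le_sum (f := fun a => P a a) (fun b _ => hP.1.diag_nonneg)
      (Finset.mem_univ a)).trans hP.2
  have hDv : Convex ℝ D := by
    refine convex_posSemidef.inter ?_
    exact convex_halfSpace_le (f := fun P : Matrix ι ι ℝ => P.trace)
      ⟨fun _ _ => by simp, fun _ _ => by simp⟩ R
  obtain ⟨μ, ν, hμ, hlag⟩ := exists_multipliers hDc hDv hobj hineq heqn t (by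
    intro P hP h1 h2
    have : ((obj P : ℝ) : EReal) ≤ sdpPrimal obj ineq eqn :=
      le_iSup₂_of_le (f := fun P _ => ((obj P : ℝ) : EReal)) P ⟨hP.1, h1, h2⟩ le_rfl
    exact EReal.coe_lt_coe_iff.1 (this.trans_lt ht1))
  set f : Matrix ι ι ℝ → ℝ := fun P => obj P + ∑ i, μ i * ineq i P + ∑ j, ν j * eqn j P with hf
  have hfaff : IsAff f := (hobj.add (.sum _ fun i _ => (hineq i).const_mul _)).add
    (.sum _ fun j _ => (heqn j).const_mul _)
  obtain ⟨H, hHs, hH⟩ := hfaff.exists_symm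
  have h0 : f 0 < t := hlag 0 ⟨Matrix.PosSemidef.zero, by simp [hR.le]⟩
  -- The trace multiplier: the largest eigenvalue of `H` is at most `τ`, since the maximum of `f`
  -- over the matrices `s v vᵀ` of trace `R` is less than `t`.
  set τ : ℝ := (t - f 0) / R with hτ
  have hτ0 : 0 ≤ τ := div_nonneg (by linarith) hR.le
  have hτR : τ * R = t - f 0 := div_mul_cancel₀ _ hR.ne'
  have hS₁ : (τ • (1 : Matrix ι ι ℝ) - H).PosSemidef := by
    refine posSemidef_iff_real.2 ⟨by simp [Matrix.IsSymm, hHs.eq], fun v => ?_⟩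
    rw [Matrix.sub_mulVec, dotProduct_sub, Matrix.smul_mulVec, Matrix.one_mulVec, dotProduct_smul,
      smul_eq_mul, sub_nonneg]
    rcases eq_or_ne v 0 with rfl | hv
    · simp
    have hvv : 0 < v ⬝ᵥ v := by
      simpa using Matrix.dotProduct_star_self_pos_iff.2 hv
    set P := (R / (v ⬝ᵥ v)) • Matrix.vecMulVec v v with hP
    have hPpsd : P.PosSemidef := (posSemidef_vecMulVec_self v).smul (div_nonneg hR.le hvv.le)
    have h1 := hlag P ⟨hPpsd, by
      simp only [hP, Set.mem_ofPred_eq, Matrix.trace_smul, Matrix.trace_vecMulVec, smul_eq_mul]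
      rw [div_mul_cancel₀ _ hvv.ne']⟩
    change f P < t at h1
    rw [hH P (posSemidef_iff_real.1 hPpsd).1, hP, mul_smul_comm, Matrix.trace_smul,
      Matrix.trace_mul_comm, trace_vecMulVec_mul, smul_eq_mul, div_mul_eq_mul_div,
      ← lt_sub_iff_add_lt, div_lt_iff₀ hvv, ← hτR] at h1
    have h2 : R * (v ⬝ᵥ H *ᵥ v) < R * (τ * (v ⬝ᵥ v)) := by linarith
    exact (lt_of_mul_lt_mul_left h2 hR.le).le
  refine iInf₂_le_of_le (fun i => μ i + τ * μ₀ i)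
    (fun i => add_nonneg (hμ i) (mul_nonneg hτ0 (hμ₀ i))) ?_
  refine iInf₂_le_of_le (fun j => ν j + τ * ν₀ j) (τ • (1 : Matrix ι ι ℝ) - H + τ • S₀) ?_
  refine iInf_le_of_le (hS₁.add (hS₀.smul hτ0)) (iSup₂_le fun P hP => ?_)
  refine EReal.coe_le_coe_iff.2 (le_of_eq ?_)
  have h1 := hH P hP
  have h2 := hcert P hP
  have h3 : τ * (R - P.trace) = τ * (∑ i, μ₀ i * ineq i P + ∑ j, ν₀ j * eqn j P
    + (S₀ * P).trace) := by rw [h2]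
  simp only [hf] at h1
  simp only [sdpLagrangian, add_mul, sub_mul, Finset.sum_add_distrib, mul_assoc,
    ← Finset.mul_sum, Matrix.trace_add, Matrix.trace_sub, smul_mul_assoc, one_mul,
    Matrix.trace_smul, smul_eq_mul]
  linarith

end SDP

/-! ### Positive semidefinite completion along a chain -/

section Gram

/-- A positive semidefinite matrix is a Gram matrix of vectors of any Euclidean space whose
coordinates contain the index set of the matrix. -/
theorem exists_gram_eq {ι κ : Type*} [Fintype ι] [Fintype κ] {f : ι → κ}
    (hf : Function.Injective f) {P : Matrix ι ι ℝ} (hP : P.PosSemidef) :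
    ∃ v : ι → EuclideanSpace ℝ κ, Matrix.gram ℝ v = P := by
  classical
  open scoped MatrixOrder in
  obtain ⟨A, hA⟩ := CStarAlgebra.nonneg_iff_eq_star_mul_self.mp hP.nonneg
  refine ⟨fun a => WithLp.toLp 2 (Function.extend f (fun j => A j a) 0), ?_⟩
  ext a b
  rw [hA, Matrix.gram_apply, Matrix.mul_apply, PiLp.inner_apply]
  refine (Fintype.sum_of_injective f hf _ _ (fun c hc => ?_) fun j => ?_).symm
  · simp [Function.extend_apply' _ _ _ (fun ⟨j, hj⟩ => hc ⟨j, hj⟩)]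
  · simp [hf.extend_apply, Matrix.star_apply, mul_comm]

variable {E : Type*} [NormedAddCommGroup E] [InnerProductSpace ℝ E]

theorem norm_linearCombination_eq_of_gram_eq {α : Type*} {u u' : α → E}
    (h : Matrix.gram ℝ u' = Matrix.gram ℝ u) (c : α →₀ ℝ) :
    ‖Finsupp.linearCombination ℝ u' c‖ = ‖Finsupp.linearCombination ℝ u c‖ := by
  have key : ∀ w : α → E, ‖Finsupp.linearCombination ℝ w c‖ ^ 2
      = c.sum fun a x => c.sum fun b y => x * y * Matrix.gram ℝ w a b := by
    intro w
    rw [← real_inner_self_eq_norm_sq, Finsupp.linearCombination_apply, Finsupp.sum_inner]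
    refine Finsupp.sum_congr fun a _ => ?_
    rw [Finsupp.inner_sum]
    refine Finsupp.sum_congr fun b _ => ?_
    rw [real_inner_smul_left, real_inner_smul_right, Matrix.gram_apply, mul_assoc]
  rw [← sq_eq_sq₀ (norm_nonneg _) (norm_nonneg _), key, key, h]

/-- Families with the same Gram matrix differ by a linear isometry. -/
theorem exists_linearIsometry_of_gram_eq [FiniteDimensional ℝ E] {α : Type*} {u u' : α → E}
    (h : Matrix.gram ℝ u' = Matrix.gram ℝ u) : ∃ T : E →ₗᵢ[ℝ] E, ∀ a, T (u' a) = u a := by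
  set g := Finsupp.linearCombination ℝ u' with hg
  set g₁ := Finsupp.linearCombination ℝ u with hg₁
  have hn : ∀ c, ‖g c‖ = ‖g₁ c‖ := norm_linearCombination_eq_of_gram_eq h
  obtain ⟨s, hs⟩ := g.rangeRestrict.exists_rightInverse_of_surjective g.range_rangeRestrict
  have hs' : ∀ x, g (s x) = x := fun x => congrArg Subtype.val (LinearMap.congr_fun hs x)
  let L : LinearMap.range g →ₗᵢ[ℝ] E :=
    { toLinearMap := g₁ ∘ₗ s
      norm_map' := fun x => by
        rw [LinearMap.comp_apply, ← hn, hs']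
        rfl }
  refine ⟨L.extend, fun a => ?_⟩
  have ha : g (Finsupp.single a 1) = u' a := by simp [hg]
  have ha₁ : g₁ (Finsupp.single a 1) = u a := by simp [hg₁]
  rw [← ha, ← ha₁]
  refine (L.extend_apply ⟨g (Finsupp.single a 1), LinearMap.mem_range_self _ _⟩).trans ?_
  change g₁ (s _) = _
  rw [← sub_eq_zero, ← map_sub, ← norm_eq_zero, ← hn, map_sub, hs', sub_self, norm_zero]

end Gram

/-- Positive semidefinite completion for a chain of cliques: positive semidefinite matrices
indexed by a common element and two consecutive layers, and agreeing on the layers they share, are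
the diagonal blocks of one Gram matrix. The vectors are built layer by layer, each new matrix being
moved by an isometry onto the vectors already chosen for the layer it shares. -/
theorem exists_chain_gram {K : ℕ} {n : Fin (K + 2) → Type*} [∀ k, Fintype (n k)] {κ : Type*}
    [Fintype κ] (P : ∀ k : Fin (K + 1),
      Matrix (Option (n k.succ ⊕ n k.castSucc)) (Option (n k.succ ⊕ n k.castSucc)) ℝ)
    (hP : ∀ k, (P k).PosSemidef)
    (hκ : ∀ k : Fin (K + 1), ∃ f : Option (n k.succ ⊕ n k.castSucc) → κ, Function.Injective f)
    (hcons : ∀ k : Fin K, (P k.castSucc).submatrix (Option.map .inl) (Option.map .inl) =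
      (P k.succ).submatrix (Option.map .inr) (Option.map .inr)) :
    ∃ (e : EuclideanSpace ℝ κ) (V : ∀ k, n k → EuclideanSpace ℝ κ), ∀ k : Fin (K + 1),
      Matrix.gram ℝ (fun o : Option (n k.succ ⊕ n k.castSucc) =>
        o.elim e (Sum.elim (V k.succ) (V k.castSucc))) = P k := by
  classical
  let M : ∀ k : Fin (K + 2), Matrix (Option (n k)) (Option (n k)) ℝ :=
    Fin.cases ((P 0).submatrix (Option.map .inr) (Option.map .inr))
      fun k => (P k).submatrix (Option.map .inl) (Option.map .inl)
  have hMs : ∀ k : Fin (K + 1),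
      M k.succ = (P k).submatrix (Option.map .inl) (Option.map .inl) := fun k => rfl
  have hMc : ∀ k : Fin (K + 1),
      M k.castSucc = (P k).submatrix (Option.map .inr) (Option.map .inr) := by
    refine Fin.cases rfl fun k => ?_
    exact (hMs k.castSucc).trans (hcons k)
  choose f hf using hκ
  choose W hW using fun k => exists_gram_eq (hf k) (hP k)
  set e := W 0 none with he
  have main : ∀ m : Fin (K + 2), ∃ V : ∀ k, n k → EuclideanSpace ℝ κ,
      Matrix.gram ℝ (fun o : Option (n m) => o.elim e (V m)) = M m ∧
      ∀ k : Fin (K + 1), k.castSucc < m →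
        Matrix.gram ℝ (fun o : Option (n k.succ ⊕ n k.castSucc) =>
          o.elim e (Sum.elim (V k.succ) (V k.castSucc))) = P k := by
    refine Fin.induction ?_ fun m ih => ?_
    · set V₀ : ∀ k, n k → EuclideanSpace ℝ κ :=
        Function.update 0 (Fin.castSucc 0) fun j => W 0 (some (.inr j))
      have hV₀ : V₀ (Fin.castSucc 0) = fun j => W 0 (some (.inr j)) := Function.update_self ..
      refine ⟨V₀, ?_, fun k hk => absurd hk (Fin.not_lt_zero _)⟩
      change _ = (P 0).submatrix (Option.map .inr) (Option.map .inr)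
      rw [← hW 0]
      refine congrArg (Matrix.gram ℝ) (?_ : _ = W 0 ∘ Option.map .inr)
      funext o
      cases o with
      | none => rfl
      | some j => exact congrFun hV₀ j
    · obtain ⟨V, hV, hVk⟩ := ih
      obtain ⟨T, hT⟩ := exists_linearIsometry_of_gram_eq
        (u := fun o : Option (n m.castSucc) => o.elim e (V m.castSucc))
        (u' := W m ∘ Option.map .inr)
        (by rw [hV, hMc, ← hW m]; rfl)
      have hTe : T (W m none) = e := hT none
      have hTV : ∀ j, T (W m (some (.inr j))) = V m.castSucc j := fun j => hT (some j)
      set V' := Function.update V m.succ fun i => T (W m (some (.inl i))) with hV'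
      have hnew : V' m.succ = fun i => T (W m (some (.inl i))) := Function.update_self ..
      have hold : ∀ k, k ≠ m.succ → V' k = V k := fun k hk => Function.update_of_ne hk ..
      have hpair : Matrix.gram ℝ (fun o : Option (n m.succ ⊕ n m.castSucc) =>
          o.elim e (Sum.elim (V' m.succ) (V' m.castSucc))) = P m := by
        rw [← hW m, hnew, hold _ m.castSucc_lt_succ.ne]
        have : (fun o : Option (n m.succ ⊕ n m.castSucc) =>
            o.elim e (Sum.elim (fun i => T (W m (some (.inl i)))) (V m.castSucc)))
            = fun o => T (W m o) := by
          funext o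
          rcases o with _ | i | j
          · exact hTe.symm
          · rfl
          · exact (hTV j).symm
        rw [this]
        ext a b
        simp only [Matrix.gram_apply, LinearIsometry.inner_map_map]
      refine ⟨V', ?_, fun k hk => ?_⟩
      · rw [hMs, ← hpair]
        refine congrArg (Matrix.gram ℝ) ?_
        funext o
        cases o <;> rfl
      · rcases (Fin.le_castSucc_iff.2 hk).lt_or_eq with hlt | heq
        · rw [hold k.succ (fun h => hlt.ne (by rw [Fin.succ_injective _ h])), hold k.castSucc hk.ne]
          exact hVk k hlt
        · obtain rfl := Fin.castSucc_injective _ heq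
          exact hpair
  obtain ⟨V, -, hV⟩ := main (Fin.last _)
  exact ⟨e, V, fun k => hV k (Fin.castSucc_lt_last k)⟩

/-! ### Moments bounded by a box constraint -/

section Moments

variable {α : Type} [Fintype α] [DecidableEq α]

/-- The coefficient vector of `x_a - s`. -/
def shift (a : α) (s : ℝ) : Option α → ℝ := Pi.single (some a) 1 - s • Pi.single none 1

/-- The moment of `(x_a - s)²`. -/
theorem shift_quadratic {P : Matrix (Option α) (Option α) ℝ} (hP : P.IsSymm) (a : α) (s : ℝ) :
    shift a s ⬝ᵥ (P *ᵥ shift a s)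
      = P (some a) (some a) - 2 * s * P none (some a) + s ^ 2 * P none none := by
  have h : P (some a) none = P none (some a) := hP.apply _ _
  simp [shift, Matrix.mulVec_sub, Matrix.mulVec_smul, sub_dotProduct, h]
  ring

/-- A box constraint on the first two moments bounds the second moment. -/
theorem diag_le_of_box {P : Matrix (Option α) (Option α) ℝ} (hP : P.PosSemidef)
    (h1 : P none none = 1) {a : α} {l u : ℝ}
    (h : P (some a) (some a) - l * P none (some a) - P none (some a) * u + l * u ≤ 0) :
    P (some a) (some a) ≤ l ^ 2 + u ^ 2 := by
  have h2 := (posSemidef_iff_real.1 hP).2 (shift a (l + u))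
  rw [shift_quadratic (posSemidef_iff_real.1 hP).1, h1] at h2
  nlinarith

end Moments

namespace Problem

section

variable {K : ℕ} {p : Problem K}

theorem isCompact_box (k : Fin (K + 1)) : IsCompact (p.box k) := isCompact_Icc

theorem ValidBounds.box_nonempty (hp : p.ValidBounds) (k : Fin (K + 1)) : (p.box k).Nonempty := by
  induction k using Fin.induction with
  | zero => exact Set.nonempty_Icc.2 hp.input
  | succ k ih => exact ih.imp' (p.layer k) fun x hx => hp.layer_mem k x hx

/-! ### The two-layer relaxation -/

/-- The value of the multiplier `λ_k` on first moments `v` and second moments `M`. -/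
def QuadMult.momEval (L : p.QuadMult) (k : Fin (K + 1)) (v : Fin (p.n k) → ℝ)
    (M : Matrix (Fin (p.n k)) (Fin (p.n k)) ℝ) : ℝ :=
  L.q k ⬝ᵥ v + (1 / 2) * (L.Q k * M).trace

/-- The first moments of the output of layer `k`. -/
def outMom (k : Fin K) (P : Matrix (p.Idx₂ k) (p.Idx₂ k) ℝ) : Fin (p.n k.succ) → ℝ :=
  fun i => P none (some (.inl i))

/-- The second moments of the output of layer `k`. -/
def outMom₂ (k : Fin K) (P : Matrix (p.Idx₂ k) (p.Idx₂ k) ℝ) :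
    Matrix (Fin (p.n k.succ)) (Fin (p.n k.succ)) ℝ :=
  P.submatrix (fun i => some (.inl i)) (fun i => some (.inl i))

/-- The first moments of the input of layer `k`. -/
def inMom (k : Fin K) (P : Matrix (p.Idx₂ k) (p.Idx₂ k) ℝ) : Fin (p.n k.castSucc) → ℝ :=
  fun j => P none (some (.inr j))

/-- The second moments of the input of layer `k`. -/
def inMom₂ (k : Fin K) (P : Matrix (p.Idx₂ k) (p.Idx₂ k) ℝ) :
    Matrix (Fin (p.n k.castSucc)) (Fin (p.n k.castSucc)) ℝ :=
  P.submatrix (fun j => some (.inr j)) (fun j => some (.inr j))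

theorem twoLayerObj_eq (L : p.QuadMult) (k : Fin K) (P : Matrix (p.Idx₂ k) (p.Idx₂ k) ℝ) :
    p.twoLayerObj L k P = L.momEval k.succ (outMom k P) (outMom₂ k P)
      - L.momEval k.castSucc (inMom k P) (inMom₂ k P) := by
  unfold twoLayerObj QuadMult.momEval outMom outMom₂ inMom inMom₂
  ring

theorem QuadMult.momEval_zero (L : p.QuadMult) (v : Fin (p.n 0) → ℝ)
    (M : Matrix (Fin (p.n 0)) (Fin (p.n 0)) ℝ) : L.momEval 0 v M = 0 := by
  simp [QuadMult.momEval, L.q_zero, L.Q_zero]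

theorem QuadMult.momEval_last (L : p.QuadMult) (v : Fin (p.n (Fin.last K)) → ℝ)
    (M : Matrix (Fin (p.n (Fin.last K))) (Fin (p.n (Fin.last K))) ℝ) :
    L.momEval (Fin.last K) v M = L.q (Fin.last K) ⬝ᵥ v := by
  simp [QuadMult.momEval, L.Q_last]

theorem QuadMult.toFun_last (L : p.QuadMult) (x : p.Act (Fin.last K)) :
    L.toFun (Fin.last K) x = L.q (Fin.last K) ⬝ᵥ x := by
  simp [QuadMult.toFun, L.Q_last]

theorem QuadMult.momEval_vecMulVec (L : p.QuadMult) (k : Fin (K + 1)) (x : p.Act k) :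
    L.momEval k x (Matrix.vecMulVec x x) = L.toFun k x := by
  rw [QuadMult.momEval, QuadMult.toFun, Matrix.trace_mul_comm, trace_vecMulVec_mul]

/-- The vector `(1, π_k x, x)`. -/
def layerVec (k : Fin K) (x : p.Act k.castSucc) : p.Idx₂ k → ℝ :=
  fun o => o.elim 1 (Sum.elim (p.layer k x) x)

/-- The moment matrix of a point mass is feasible for the two-layer relaxation. -/
theorem ValidBounds.twoLayerFeasible (hp : p.ValidBounds) {k : Fin K} {x : p.Act k.castSucc}
    (hx : x ∈ p.box k.castSucc) :
    p.TwoLayerFeasible k (Matrix.vecMulVec (layerVec k x) (layerVec k x)) := by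
  have hy := hp.layer_mem k x hx
  have hbox : ∀ {l u y : ℝ}, l ≤ y → y ≤ u → y * y - l * y - y * u + l * u ≤ 0 :=
    fun h1 h2 => by nlinarith
  have hz : ∀ i, (p.w k *ᵥ x + p.b k) i = ∑ j, p.w k i j * x j + p.b k i := fun i => rfl
  refine ⟨posSemidef_vecMulVec_self _, ?_, fun j => ?_, fun i => ?_, fun i => ?_, fun i => ?_,
    fun i => ?_⟩
  · simp [layerVec, Matrix.vecMulVec_apply]
  · simpa [layerVec, Matrix.vecMulVec_apply] using hbox (hx.1 j) (hx.2 j)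
  · simpa [layerVec, Matrix.vecMulVec_apply] using hbox (hy.1 i) (hy.2 i)
  · simp [layerVec, Matrix.vecMulVec_apply, layer]
  · simp only [layerVec, Matrix.vecMulVec_apply, layer, hz, Option.elim, Sum.elim_inl,
      Sum.elim_inr, one_mul]
    exact le_max_left _ _
  · simp only [layerVec, Matrix.vecMulVec_apply, Option.elim, Sum.elim_inl, Sum.elim_inr, one_mul,
      ← mul_assoc, ← Finset.sum_mul]
    rw [mul_comm (p.layer k x i) (p.b k i), ← add_mul, ← hz]
    unfold layer
    -- `z · ReLU z = (ReLU z)²`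
    rcases le_total ((p.w k *ᵥ x + p.b k) i) 0 with h | h
    · rw [max_eq_right h]; ring
    · rw [max_eq_left h]

theorem ValidBounds.innerMax_le_innerSDP (hp : p.ValidBounds) (L : p.QuadMult) (k : Fin K) :
    p.innerMax L.toFun k ≤ p.innerSDP L k := by
  unfold innerMax innerSDP
  refine iSup₂_le fun x hx => le_iSup₂_of_le _ (hp.twoLayerFeasible hx) ?_
  rw [twoLayerObj_eq, ← L.momEval_vecMulVec, ← L.momEval_vecMulVec]
  refine EReal.coe_le_coe_iff.2 (le_of_eq ?_)
  have h1 : outMom k (Matrix.vecMulVec (layerVec k x) (layerVec k x)) = p.layer k x := by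
    funext i; simp [outMom, layerVec, Matrix.vecMulVec_apply]
  have h2 : inMom k (Matrix.vecMulVec (layerVec k x) (layerVec k x)) = x := by
    funext i; simp [inMom, layerVec, Matrix.vecMulVec_apply]
  rw [h1, h2]
  rfl

theorem ValidBounds.dualFun_le_dualFunSDP (hp : p.ValidBounds) (L : p.QuadMult) :
    p.dualFun L.toFun ≤ p.dualFunSDP L :=
  add_le_add_left (Finset.sum_le_sum fun k _ => hp.innerMax_le_innerSDP L k) _

/-- The feasible set `Δ_k`, cut out of the positive semidefinite cone by affine constraints. -/
theorem setOf_twoLayerFeasible (k : Fin K) :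
    {P | p.TwoLayerFeasible k P} = {P | P.PosSemidef} ∩ {P | P none none - 1 = 0} ∩
      (⋂ j, {P | P (some (.inr j)) (some (.inr j)) - p.l k.castSucc j * P none (some (.inr j))
        - P none (some (.inr j)) * p.u k.castSucc j
        + p.l k.castSucc j * p.u k.castSucc j ≤ 0}) ∩
      (⋂ i, {P | P (some (.inl i)) (some (.inl i)) - p.l k.succ i * P none (some (.inl i))
        - P none (some (.inl i)) * p.u k.succ i + p.l k.succ i * p.u k.succ i ≤ 0}) ∩
      (⋂ i, {P | -P none (some (.inl i)) ≤ 0}) ∩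
      (⋂ i, {P | ∑ j, p.w k i j * P none (some (.inr j)) + p.b k i
        - P none (some (.inl i)) ≤ 0}) ∩
      (⋂ i, {P | ∑ j, p.w k i j * P (some (.inr j)) (some (.inl i))
        + P none (some (.inl i)) * p.b k i - P (some (.inl i)) (some (.inl i)) = 0}) := by
  ext P
  simp only [Set.mem_inter_iff, Set.mem_iInter, Set.mem_ofPred_eq, sub_eq_zero, neg_nonpos,
    sub_nonpos]
  exact ⟨fun h => ⟨⟨⟨⟨⟨⟨h.psd, h.one⟩, h.box_x⟩, h.box_y⟩, h.nonneg⟩, h.ge_affine⟩, h.compl⟩,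
    fun ⟨⟨⟨⟨⟨⟨h1, h2⟩, h3⟩, h4⟩, h5⟩, h6⟩, h7⟩ => ⟨h1, h2, h3, h4, h5, h6, h7⟩⟩

theorem isAff_box {ι : Type} (a b : ι) (c : ι) (l u : ℝ) :
    IsAff fun P : Matrix ι ι ℝ => P a b - l * P c b - P c b * u + l * u :=
  (((isAff_entry a b).sub ((isAff_entry c b).const_mul l)).sub
    ((isAff_entry c b).mul_const u)).add (.const _)

theorem convex_twoLayerFeasible (k : Fin K) : Convex ℝ {P | p.TwoLayerFeasible k P} := by
  rw [setOf_twoLayerFeasible]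
  refine (((((convex_posSemidef.inter (IsAff.convex_eq ?_)).inter (convex_iInter fun _ =>
    IsAff.convex_le ?_)).inter (convex_iInter fun _ => IsAff.convex_le ?_)).inter
    (convex_iInter fun _ => IsAff.convex_le ?_)).inter (convex_iInter fun _ =>
    IsAff.convex_le ?_)).inter (convex_iInter fun _ => IsAff.convex_eq ?_)
  · exact (isAff_entry _ _).sub (.const _)
  · exact isAff_box _ _ _ _ _
  · exact isAff_box _ _ _ _ _
  · exact (isAff_entry _ _).neg
  · exact ((IsAff.sum _ fun j _ => (isAff_entry _ _).const_mul _).add (.const _)).sub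
      (isAff_entry _ _)
  · exact ((IsAff.sum _ fun j _ => (isAff_entry _ _).const_mul _).add
      ((isAff_entry _ _).mul_const _)).sub (isAff_entry _ _)

theorem isClosed_twoLayerFeasible (k : Fin K) : IsClosed {P | p.TwoLayerFeasible k P} := by
  rw [setOf_twoLayerFeasible]
  refine (((((isClosed_posSemidef.inter (IsAff.isClosed_eq ?_)).inter (isClosed_iInter fun _ =>
    IsAff.isClosed_le ?_)).inter (isClosed_iInter fun _ => IsAff.isClosed_le ?_)).inter
    (isClosed_iInter fun _ => IsAff.isClosed_le ?_)).inter (isClosed_iInter fun _ =>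
    IsAff.isClosed_le ?_)).inter (isClosed_iInter fun _ => IsAff.isClosed_eq ?_)
  · exact (isAff_entry _ _).sub (.const _)
  · exact isAff_box _ _ _ _ _
  · exact isAff_box _ _ _ _ _
  · exact (isAff_entry _ _).neg
  · exact ((IsAff.sum _ fun j _ => (isAff_entry _ _).const_mul _).add (.const _)).sub
      (isAff_entry _ _)
  · exact ((IsAff.sum _ fun j _ => (isAff_entry _ _).const_mul _).add
      ((isAff_entry _ _).mul_const _)).sub (isAff_entry _ _)

theorem isCompact_twoLayerFeasible (k : Fin K) : IsCompact {P | p.TwoLayerFeasible k P} := by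
  set C : ℝ := 1 + ∑ i, (p.l k.succ i ^ 2 + p.u k.succ i ^ 2)
    + ∑ j, (p.l k.castSucc j ^ 2 + p.u k.castSucc j ^ 2) with hC
  have hy : 0 ≤ ∑ i, (p.l k.succ i ^ 2 + p.u k.succ i ^ 2) :=
    Finset.sum_nonneg fun _ _ => by positivity
  have hx : 0 ≤ ∑ j, (p.l k.castSucc j ^ 2 + p.u k.castSucc j ^ 2) :=
    Finset.sum_nonneg fun _ _ => by positivity
  refine isCompact_of_posSemidef (isClosed_twoLayerFeasible k) (fun P hP => hP.psd) C
    fun P hP a => ?_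
  rcases a with _ | i | j
  · rw [hP.one]; linarith
  · have h1 := diag_le_of_box hP.psd hP.one (hP.box_y i)
    have h2 := Finset.single_le_sum (f := fun i => p.l k.succ i ^ 2 + p.u k.succ i ^ 2)
      (fun _ _ => by positivity) (Finset.mem_univ i)
    linarith
  · have h1 := diag_le_of_box hP.psd hP.one (hP.box_x j)
    have h2 := Finset.single_le_sum (f := fun j => p.l k.castSucc j ^ 2 + p.u k.castSucc j ^ 2)
      (fun _ _ => by positivity) (Finset.mem_univ j)
    linarith

theorem isAff_twoLayerObj (L : p.QuadMult) (k : Fin K) : IsAff (p.twoLayerObj L k) := by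
  unfold twoLayerObj dotProduct Matrix.trace
  simp only [Matrix.diag_apply, Matrix.mul_apply, Matrix.submatrix_apply]
  refine (((IsAff.sum _ fun i _ => (isAff_entry _ _).const_mul _).add (.const_mul _ ?_)).sub
    (.sum _ fun i _ => (isAff_entry _ _).const_mul _)).sub (.const_mul _ ?_) <;>
  exact .sum _ fun i _ => .sum _ fun j _ => (isAff_entry _ _).const_mul _

/-- The two-layer relaxation attains its value. -/
theorem ValidBounds.exists_innerSDP_eq (hp : p.ValidBounds) (L : p.QuadMult) (k : Fin K) :
    ∃ P, p.TwoLayerFeasible k P ∧ p.innerSDP L k = (p.twoLayerObj L k P : ℝ) := by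
  obtain ⟨x, hx⟩ := hp.box_nonempty k.castSucc
  obtain ⟨P, hP, hmax⟩ := (isCompact_twoLayerFeasible k).exists_isMaxOn
    ⟨_, hp.twoLayerFeasible hx⟩ (isAff_twoLayerObj L k).continuous.continuousOn
  refine ⟨P, hP, le_antisymm (iSup₂_le fun P' hP' => EReal.coe_le_coe_iff.2 (hmax hP')) ?_⟩
  exact le_iSup₂_of_le (f := fun P _ => ((p.twoLayerObj L k P : ℝ) : EReal)) P hP le_rfl

theorem ValidBounds.exists_finalMax_eq (hp : p.ValidBounds) (L : p.QuadMult) :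
    ∃ x ∈ p.box (Fin.last K),
      p.finalMax L.toFun = ((p.c ⬝ᵥ x - L.q (Fin.last K) ⬝ᵥ x : ℝ) : EReal) := by
  obtain ⟨x, hx, hmax⟩ := (isCompact_box (Fin.last K)).exists_isMaxOn (hp.box_nonempty _)
    (f := fun x => p.c ⬝ᵥ x - L.q (Fin.last K) ⬝ᵥ x) (by fun_prop)
  refine ⟨x, hx, ?_⟩
  unfold finalMax
  simp only [L.toFun_last]
  refine le_antisymm (iSup₂_le fun y hy => EReal.coe_le_coe_iff.2 (hmax hy)) ?_
  exact le_iSup₂_of_le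
    (f := fun x _ => ((p.c ⬝ᵥ x - L.q (Fin.last K) ⬝ᵥ x : ℝ) : EReal)) x hx le_rfl

/-! ### The relaxation of the whole network -/

theorem coe_sum_ereal {ι : Type*} (s : Finset ι) (f : ι → ℝ) :
    ((∑ i ∈ s, f i : ℝ) : EReal) = ∑ i ∈ s, (f i : EReal) :=
  map_sum (⟨⟨Real.toEReal, EReal.coe_zero⟩, EReal.coe_add⟩ : ℝ →+ EReal) f s

/-- The inclusion of the variables of two consecutive layers in those of the network. -/
def emb (k : Fin K) : p.Idx₂ k → p.Idx :=
  Option.map (Sum.elim (fun i => ⟨k.succ, i⟩) (fun j => ⟨k.castSucc, j⟩))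

theorem emb_injective (k : Fin K) : Function.Injective (emb (p := p) k) := by
  refine Option.map_injective (Function.Injective.sumElim
    (fun _ _ h => eq_of_heq (Sigma.mk.inj h).2) (fun _ _ h => eq_of_heq (Sigma.mk.inj h).2)
    fun i j h => ?_)
  exact k.castSucc_lt_succ.ne' (congrArg Sigma.fst h)

/-- Feasibility for the relaxation of the whole network. -/
def NetFeasible (p : Problem K) (P : Matrix p.Idx p.Idx ℝ) : Prop :=
  P.PosSemidef ∧ (∀ i, 0 ≤ p.netIneq i P) ∧ ∀ j, p.netEq j P = 0

theorem NetFeasible.twoLayerFeasible {P : Matrix p.Idx p.Idx ℝ} (h : p.NetFeasible P)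
    (k : Fin K) : p.TwoLayerFeasible k (P.submatrix (emb k) (emb k)) := by
  obtain ⟨h1, h2, h3⟩ := h
  refine ⟨h1.submatrix _, ?_, fun j => ?_, fun i => ?_, fun i => ?_, fun i => ?_, fun i => ?_⟩
  · exact sub_eq_zero.1 (h3 none)
  · exact neg_nonneg.1 (h2 (.inl ⟨k.castSucc, j⟩))
  · exact neg_nonneg.1 (h2 (.inl ⟨k.succ, i⟩))
  · exact h2 (.inr (.inl ⟨k, i⟩))
  · exact sub_nonneg.1 (h2 (.inr (.inr (.inl ⟨k, i⟩))))
  · exact sub_eq_zero.1 (h3 (some ⟨k, i⟩))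

theorem NetFeasible.mem_box {P : Matrix p.Idx p.Idx ℝ} (h : p.NetFeasible P) :
    p.mom₁ P (Fin.last K) ∈ p.box (Fin.last K) :=
  ⟨fun i => sub_nonneg.1 (h.2.1 (.inr (.inr (.inr (.inl i))))),
    fun i => sub_nonneg.1 (h.2.1 (.inr (.inr (.inr (.inr i)))))⟩

theorem sum_succ_sub_castSucc (F : Fin (K + 1) → ℝ) :
    ∑ k : Fin K, (F k.succ - F k.castSucc) = F (Fin.last K) - F 0 := by
  have h := Fin.sum_univ_succ F
  rw [Fin.sum_univ_castSucc] at h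
  rw [Finset.sum_sub_distrib]
  linarith

/-- On a feasible matrix of the whole network, the two-layer objectives telescope. -/
theorem netSDP_le_dualFunSDP (L : p.QuadMult) : p.netSDP ≤ p.dualFunSDP L := by
  refine iSup₂_le fun P hP => ?_
  replace hP : p.NetFeasible P := hP
  set x := p.mom₁ P (Fin.last K) with hx
  have key : p.netObj P = ∑ k : Fin K, p.twoLayerObj L k (P.submatrix (emb k) (emb k))
      + (p.c ⬝ᵥ x - L.toFun (Fin.last K) x) := by
    have h := sum_succ_sub_castSucc fun k => L.momEval k (p.mom₁ P k)
      (P.submatrix (fun i => some ⟨k, i⟩) (fun i => some ⟨k, i⟩))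
    rw [L.momEval_last, L.momEval_zero, sub_zero] at h
    simp only [twoLayerObj_eq]
    rw [L.toFun_last]
    refine Eq.trans ?_ (congrArg (· + _) h.symm)
    simp only [netObj, ← hx]
    ring
  rw [key, EReal.coe_add, coe_sum_ereal]
  refine add_le_add (Finset.sum_le_sum fun k _ => ?_) ?_
  · exact le_iSup₂_of_le (f := fun P _ => ((p.twoLayerObj L k P : ℝ) : EReal)) _
      (hP.twoLayerFeasible k) le_rfl
  · exact le_iSup₂_of_le
      (f := fun x _ => ((p.c ⬝ᵥ x - L.toFun (Fin.last K) x : ℝ) : EReal)) x hP.mem_box le_rfl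

theorem netSDP_le_flDualValue : p.netSDP ≤ p.flDualValue := le_iInf netSDP_le_dualFunSDP

/-! ### Strong duality for the relaxation of the whole network -/

theorem isAff_netObj : IsAff p.netObj :=
  IsAff.sum Finset.univ (f := fun i (P : Matrix p.Idx p.Idx ℝ) => p.c i * P none (some ⟨Fin.last K, i⟩))
    fun _ _ => (isAff_entry _ _).const_mul _

theorem isAff_netIneq (i : p.IneqIdx) : IsAff (p.netIneq i) := by
  rcases i with a | a | a | i | i
  · exact (isAff_box _ _ _ _ _).neg
  · exact isAff_entry _ _
  · exact (isAff_entry _ _).sub ((IsAff.sum _ fun j _ => (isAff_entry _ _).const_mul _).add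
      (.const _))
  · exact (isAff_entry _ _).sub (.const _)
  · exact (IsAff.const _).sub (isAff_entry _ _)

theorem isAff_netEq (j : Option p.Unit₁) : IsAff (p.netEq j) := by
  rcases j with _ | a
  · exact (isAff_entry _ _).sub (.const _)
  · exact ((IsAff.sum _ fun j _ => (isAff_entry _ _).const_mul _).add
      ((isAff_entry _ _).mul_const _)).sub (isAff_entry _ _)

/-- The box constraints certify a bound on the trace: with `s = l + u`,
`l² + u² - X = 2 (s x - l u - X) + (X - 2 s x + s²)`, where `x` and `X` are the first and second
moments of a coordinate and the last term is the moment of its squared distance from `s`. -/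
theorem netSDPDual_le_netSDP : p.netSDPDual ≤ p.netSDP := by
  classical
  set s : p.Var → ℝ := fun a => p.l a.1 a.2 + p.u a.1 a.2 with hs
  set R : ℝ := 1 + ∑ a : p.Var, (p.l a.1 a.2 ^ 2 + p.u a.1 a.2 ^ 2) with hR
  have hR0 : 0 < R := by
    have : 0 ≤ ∑ a : p.Var, (p.l a.1 a.2 ^ 2 + p.u a.1 a.2 ^ 2) :=
      Finset.sum_nonneg fun _ _ => by positivity
    linarith
  refine sdpDual_le_sdpPrimal isAff_netObj isAff_netIneq isAff_netEq hR0
    (μ₀ := Sum.elim (fun _ => 2) fun _ => 0)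
    (ν₀ := fun o => o.elim (-(1 + ∑ a, s a ^ 2)) fun _ => 0)
    (S₀ := ∑ a, Matrix.vecMulVec (shift a (s a)) (shift a (s a))) ?_
    (Matrix.posSemidef_sum _ fun a _ => posSemidef_vecMulVec_self _) fun P hP => ?_
  · rintro (_ | _) <;> simp
  · have h1 : ((∑ a, Matrix.vecMulVec (shift a (s a)) (shift a (s a))) * P).trace
        = ∑ a, (P (some a) (some a) - 2 * s a * P none (some a) + s a ^ 2 * P none none) := by
      rw [Finset.sum_mul, Matrix.trace_sum]
      exact Finset.sum_congr rfl fun a _ => by rw [trace_vecMulVec_mul, shift_quadratic hP]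
    have h2 : ∀ a, p.netIneq (.inl a) P = s a * P none (some a) - P (some a) (some a)
        - p.l a.1 a.2 * p.u a.1 a.2 := fun a => by
      simp only [netIneq, Sum.elim_inl, netBox, mom₁, mom₂, hs]; ring
    rw [h1, Fintype.sum_sum_type, Fintype.sum_option]
    simp only [Sum.elim_inl, Sum.elim_inr, zero_mul, Finset.sum_const_zero, add_zero, Option.elim,
      h2, netEq, Matrix.trace, Fintype.sum_option, Matrix.diag_apply, hR]
    have h3 : ∑ a : p.Var, (p.l a.1 a.2 ^ 2 + p.u a.1 a.2 ^ 2) - ∑ a, P (some a) (some a)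
        = ∑ a, 2 * (s a * P none (some a) - P (some a) (some a) - p.l a.1 a.2 * p.u a.1 a.2)
          - (∑ a, s a ^ 2) * (P none none - 1)
          + ∑ a, (P (some a) (some a) - 2 * s a * P none (some a) + s a ^ 2 * P none none) := by
      rw [Finset.sum_mul, ← Finset.sum_sub_distrib, ← Finset.sum_sub_distrib,
        ← Finset.sum_add_distrib]
      exact Finset.sum_congr rfl fun a _ => by simp only [hs]; ring
    linarith

/-! ### Strong duality for the functional Lagrangian -/

theorem half_trace_add_transpose_mul {m : Type*} [Fintype m] (N : Matrix m m ℝ)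
    {M : Matrix m m ℝ} (hM : M.IsSymm) :
    (1 / 2) * ((N + Nᵀ) * M).trace = ∑ a, ∑ b, N a b * M a b := by
  have h1 : (Nᵀ * M).trace = (N * M).trace := by
    rw [← Matrix.trace_transpose, Matrix.transpose_mul, hM.eq, Matrix.transpose_transpose,
      Matrix.trace_mul_comm]
  have h2 : (N * M).trace = ∑ a, ∑ b, N a b * M a b := by
    simp only [Matrix.trace, Matrix.diag_apply, Matrix.mul_apply]
    exact Finset.sum_congr rfl fun a _ => Finset.sum_congr rfl fun b _ => by rw [hM.apply]
  rw [add_mul, Matrix.trace_add, h1, h2]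
  ring

end

section

-- A positive number of layers, written `K + 1`: the inner layers are then `k.castSucc.succ`, which
-- is definitionally `k.succ.castSucc`, for `k : Fin K`.
variable {K : ℕ} {p : Problem (K + 1)}

/-- Two-layer matrices that agree on shared layers come from a feasible matrix of the whole
network, provided the last first moments lie in the last box. -/
theorem exists_netFeasible {P : ∀ k : Fin (K + 1), Matrix (p.Idx₂ k) (p.Idx₂ k) ℝ}
    (hP : ∀ k, p.TwoLayerFeasible k (P k))
    (h₁ : ∀ k : Fin K, outMom k.castSucc (P k.castSucc) = inMom k.succ (P k.succ))
    (h₂ : ∀ k : Fin K, outMom₂ k.castSucc (P k.castSucc) = inMom₂ k.succ (P k.succ))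
    (hlast : outMom (Fin.last K) (P (Fin.last K)) ∈ p.box (Fin.last (K + 1))) :
    ∃ N, p.NetFeasible N ∧ p.mom₁ N (Fin.last (K + 1)) = outMom (Fin.last K) (P (Fin.last K)) := by
  have hsymm : ∀ k, (P k).IsSymm := fun k => (posSemidef_iff_real.1 (hP k).psd).1
  obtain ⟨e, V, hV⟩ := exists_chain_gram (n := fun k => Fin (p.n k)) (κ := p.Idx) P
    (fun k => (hP k).psd) (fun k => ⟨emb k, emb_injective k⟩) fun k => by
      ext a b
      rcases a with _ | a <;> rcases b with _ | b
      · exact (hP k.castSucc).one.trans (hP k.succ).one.symm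
      · exact congrFun (h₁ k) b
      · refine ((hsymm k.castSucc).apply _ _).trans (Eq.trans ?_ ((hsymm k.succ).apply _ _).symm)
        exact congrFun (h₁ k) a
      · exact congrFun (congrFun (h₂ k) a) b
  set N : Matrix p.Idx p.Idx ℝ := Matrix.gram ℝ fun o => o.elim e fun a => V a.1 a.2 with hN
  have hsub : ∀ k, N.submatrix (emb k) (emb k) = P k := fun k => by
    rw [← hV k]
    ext a b
    rcases a with _ | a | a <;> rcases b with _ | b | b <;> rfl
  have hent : ∀ k a b, N (emb k a) (emb k b) = P k a b := fun k a b =>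
    congrFun (congrFun (hsub k) a) b
  have hF : ∀ k, p.TwoLayerFeasible k (N.submatrix (emb k) (emb k)) := fun k =>
    (hsub k).symm ▸ hP k
  have hl : p.mom₁ N (Fin.last (K + 1)) = outMom (Fin.last K) (P (Fin.last K)) :=
    funext fun i => hent (Fin.last K) none (some (.inl i))
  refine ⟨N, ⟨Matrix.posSemidef_gram _ _, ?_, ?_⟩, hl⟩
  · rintro (⟨k, i⟩ | ⟨k, i⟩ | ⟨k, i⟩ | i | i)
    · induction k using Fin.cases with
      | zero => exact neg_nonneg.2 ((hF 0).box_x i)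
      | succ k => exact neg_nonneg.2 ((hF k).box_y i)
    · exact (hF k).nonneg i
    · exact sub_nonneg.2 ((hF k).ge_affine i)
    · exact sub_nonneg.2 ((hlast.1 i).trans_eq (congrFun hl i).symm)
    · exact sub_nonneg.2 ((congrFun hl i).trans_le (hlast.2 i))
  · rintro (_ | ⟨k, i⟩)
    · exact sub_eq_zero.2 (hF 0).one
    · exact sub_eq_zero.2 ((hF k).compl i)

/-- The index set of the consistency equations: first and second moments of the inner
layers, each shared by two consecutive two-layer matrices, and the first moments of the last
layer. -/
abbrev ConsIdx (p : Problem (K + 1)) : Type :=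
  ((k : Fin K) × (Fin (p.n k.castSucc.succ) ⊕
    Fin (p.n k.castSucc.succ) × Fin (p.n k.castSucc.succ))) ⊕ Fin (p.n (Fin.last K).succ)

/-- Families of two-layer matrices, together with a point of the last layer. -/
abbrev Family (p : Problem (K + 1)) : Type :=
  (∀ k : Fin (K + 1), Matrix (p.Idx₂ k) (p.Idx₂ k) ℝ) × p.Act (Fin.last (K + 1))

/-- The mismatch of a family at a shared moment. -/
def mismatch : p.ConsIdx → p.Family → ℝ
  | .inl ⟨k, .inl a⟩, z => outMom k.castSucc (z.1 k.castSucc) a - inMom k.succ (z.1 k.succ) a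
  | .inl ⟨k, .inr (a, b)⟩, z =>
    outMom₂ k.castSucc (z.1 k.castSucc) a b - inMom₂ k.succ (z.1 k.succ) a b
  | .inr a, z => outMom (Fin.last K) (z.1 (Fin.last K)) a - z.2 a

theorem isAff_family_entry (k : Fin (K + 1)) (a b : p.Idx₂ k) :
    IsAff fun z : p.Family => z.1 k a b :=
  .of_isLinearMap ⟨fun _ _ => rfl, fun _ _ => rfl⟩

theorem isAff_family_snd (a : Fin (p.n (Fin.last (K + 1)))) : IsAff fun z : p.Family => z.2 a :=
  .of_isLinearMap ⟨fun _ _ => rfl, fun _ _ => rfl⟩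

theorem isAff_mismatch (j : p.ConsIdx) : IsAff (mismatch j) := by
  rcases j with ⟨k, a | ⟨a, b⟩⟩ | a
  · exact (isAff_family_entry _ _ _).sub (isAff_family_entry _ _ _)
  · exact (isAff_family_entry _ _ _).sub (isAff_family_entry _ _ _)
  · exact (isAff_family_entry _ _ _).sub (isAff_family_snd _)

/-- The quadratic multipliers with given multipliers of the consistency equations. The matrix of
multipliers of the second moments is symmetrized as `N + Nᵀ`, since `λ_k` carries a factor `½`. -/
def multOf (ν : p.ConsIdx → ℝ) : p.QuadMult where
  q := Fin.cases 0 (Fin.lastCases (fun a => ν (.inr a)) fun k a => ν (.inl ⟨k, .inl a⟩))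
  Q := Fin.cases 0 (Fin.lastCases 0 fun k =>
    Matrix.of (fun a b => ν (.inl ⟨k, .inr (a, b)⟩))
      + (Matrix.of fun a b => ν (.inl ⟨k, .inr (a, b)⟩))ᵀ)
  symm := by
    refine Fin.cases (by simp [Matrix.IsSymm]) fun k => ?_
    rw [Fin.cases_succ]
    induction k using Fin.lastCases with
    | last => simp [Matrix.IsSymm]
    | cast k => simp [Matrix.IsSymm, add_comm]
  q_zero := rfl
  Q_zero := rfl
  Q_last := by
    rw [← Fin.succ_last, Fin.cases_succ, Fin.lastCases_last]

/-- The functional Lagrangian with SDP-relaxed inner problems is the Lagrangian of the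
consistency equations. -/
theorem sum_twoLayerObj_multOf (ν : p.ConsIdx → ℝ) (z : p.Family) (hz : ∀ k, (z.1 k).IsSymm) :
    ∑ k, p.twoLayerObj (multOf ν) k (z.1 k)
      + (p.c ⬝ᵥ z.2 - (multOf ν).q (Fin.last (K + 1)) ⬝ᵥ z.2)
      = p.c ⬝ᵥ z.2 + ∑ j, ν j * mismatch j z := by
  have hq : ∀ k : Fin K, (multOf ν).q k.castSucc.succ = fun a => ν (.inl ⟨k, .inl a⟩) := fun k => by
    simp only [multOf, Fin.cases_succ, Fin.lastCases_castSucc]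
  have hQ : ∀ k : Fin K, (multOf ν).Q k.castSucc.succ =
      Matrix.of (fun a b => ν (.inl ⟨k, .inr (a, b)⟩))
        + (Matrix.of fun a b => ν (.inl ⟨k, .inr (a, b)⟩))ᵀ := fun k => by
    simp only [multOf, Fin.cases_succ, Fin.lastCases_castSucc]
  have hql : (multOf ν).q (Fin.last K).succ = fun a => ν (.inr a) := by
    simp only [multOf, Fin.cases_succ, Fin.lastCases_last]
  have hmom : ∀ (k : Fin K) (v : Fin (p.n k.castSucc.succ) → ℝ)
      (M : Matrix (Fin (p.n k.castSucc.succ)) (Fin (p.n k.castSucc.succ)) ℝ), M.IsSymm →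
      (multOf ν).momEval k.castSucc.succ v M = ∑ a, ν (.inl ⟨k, .inl a⟩) * v a
        + ∑ a, ∑ b, ν (.inl ⟨k, .inr (a, b)⟩) * M a b := fun k v M hM => by
    rw [QuadMult.momEval, hq, hQ, half_trace_add_transpose_mul _ hM]
    rfl
  have hmid : ∀ k : Fin K,
      (multOf ν).momEval k.castSucc.succ (outMom k.castSucc (z.1 k.castSucc))
          (outMom₂ k.castSucc (z.1 k.castSucc))
        - (multOf ν).momEval k.succ.castSucc (inMom k.succ (z.1 k.succ))
          (inMom₂ k.succ (z.1 k.succ))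
        = ∑ a, ν (.inl ⟨k, a⟩) * mismatch (.inl ⟨k, a⟩) z := fun k => by
    have h1 := hmom k (outMom k.castSucc (z.1 k.castSucc)) (outMom₂ k.castSucc (z.1 k.castSucc))
      ((hz k.castSucc).submatrix _)
    have h2 := hmom k (inMom k.succ (z.1 k.succ)) (inMom₂ k.succ (z.1 k.succ))
      ((hz k.succ).submatrix _)
    refine (congrArg₂ (· - ·) h1 h2).trans ?_
    rw [Fintype.sum_sum_type, Fintype.sum_prod_type]
    simp only [mismatch, mul_sub, Finset.sum_sub_distrib]
    ring
  simp only [twoLayerObj_eq, Finset.sum_sub_distrib]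
  rw [Fin.sum_univ_castSucc (fun k => (multOf ν).momEval k.succ _ _),
    Fin.sum_univ_succ (fun k => (multOf ν).momEval k.castSucc _ _), Fintype.sum_sum_type,
    Fintype.sum_sigma, ← Finset.sum_congr rfl fun k _ => hmid k, Finset.sum_sub_distrib]
  have h0 := (multOf ν).momEval_zero (inMom 0 (z.1 0)) (inMom₂ 0 (z.1 0))
  have h1 := (multOf ν).momEval_last (outMom (Fin.last K) (z.1 (Fin.last K)))
    (outMom₂ (Fin.last K) (z.1 (Fin.last K)))
  have h2 : (multOf ν).q (Fin.last (K + 1)) ⬝ᵥ outMom (Fin.last K) (z.1 (Fin.last K))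
      - (multOf ν).q (Fin.last (K + 1)) ⬝ᵥ z.2 = ∑ a, ν (.inr a) * mismatch (.inr a) z := by
    rw [← dotProduct_sub]
    change (multOf ν).q (Fin.last K).succ ⬝ᵥ _ = _
    rw [hql]
    rfl
  rw [← h2]
  simp only [Fin.castSucc_zero, Fin.succ_last] at *
  linarith

theorem ValidBounds.flDualValue_le_netSDP (hp : p.ValidBounds) : p.flDualValue ≤ p.netSDP := by
  by_contra! hlt
  obtain ⟨t, ht1, ht2⟩ := EReal.lt_iff_exists_real_btwn.1 hlt
  refine absurd ht2 (not_lt.2 ?_)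
  set D : Set p.Family :=
    (Set.univ.pi fun k => {P | p.TwoLayerFeasible k P}) ×ˢ p.box (Fin.last (K + 1)) with hD
  have hDc : IsCompact D :=
    (isCompact_univ_pi fun k => isCompact_twoLayerFeasible k).prod (isCompact_box _)
  have hDv : Convex ℝ D :=
    (convex_pi fun k _ => convex_twoLayerFeasible k).prod (convex_Icc _ _)
  have hobj : IsAff fun z : p.Family => p.c ⬝ᵥ z.2 :=
    .sum _ fun a _ => (isAff_family_snd a).const_mul _
  obtain ⟨_, ν, -, hν⟩ := exists_multipliers (I := Empty) hDc hDv hobj (g := fun i => i.elim)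
    (fun i => i.elim) isAff_mismatch t (by
      rintro ⟨P, x⟩ ⟨hP, hx⟩ - hc
      replace hP : ∀ k, p.TwoLayerFeasible k (P k) := fun k => hP k trivial
      have hl : outMom (Fin.last K) (P (Fin.last K)) = x :=
        funext fun a => sub_eq_zero.1 (hc (.inr a))
      obtain ⟨N, hN, hNl⟩ := exists_netFeasible hP
        (fun k => funext fun a => sub_eq_zero.1 (hc (.inl ⟨k, .inl a⟩)))
        (fun k => Matrix.ext fun a b => sub_eq_zero.1 (hc (.inl ⟨k, .inr (a, b)⟩)))
        (hl.symm ▸ hx)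
      have h1 : ((p.netObj N : ℝ) : EReal) ≤ p.netSDP :=
        le_iSup₂_of_le (f := fun P _ => ((p.netObj P : ℝ) : EReal)) N hN le_rfl
      rw [netObj, hNl, hl] at h1
      exact EReal.coe_lt_coe_iff.1 (h1.trans_lt ht1))
  refine iInf_le_of_le (multOf ν) ?_
  choose P hP hPmax using hp.exists_innerSDP_eq (multOf ν)
  obtain ⟨x, hx, hxmax⟩ := hp.exists_finalMax_eq (multOf ν)
  rw [dualFunSDP, hxmax, Finset.sum_congr rfl fun k _ => hPmax k, ← coe_sum_ereal, ← EReal.coe_add,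
    EReal.coe_le_coe_iff]
  have h := hν (P, x) ⟨fun k _ => hP k, hx⟩
  rw [Finset.univ_eq_empty, Finset.sum_empty, add_zero] at h
  exact (sum_twoLayerObj_multOf ν (P, x)
    fun k => (posSemidef_iff_real.1 (hP k).psd).1).trans_le h.le

end

end Problem

end

end FunLag

theorem mainTheorem5 (K : ℕ) (hK : 1 ≤ K) (p : FunLag.Problem K) (hp : p.ValidBounds) :
    (∀ L : p.QuadMult,
      (∀ k : Fin K, p.innerMax L.toFun k ≤ p.innerSDP L k) ∧
        p.dualFun L.toFun ≤ p.dualFunSDP L) ∧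
    p.flDualValue = p.netSDPDual ∧
    p.netSDPDual = p.netSDP := by
  obtain ⟨K, rfl⟩ : ∃ m, K = m + 1 := ⟨K - 1, by omega⟩
  have h1 : p.netSDPDual = p.netSDP :=
    le_antisymm FunLag.Problem.netSDPDual_le_netSDP FunLag.sdpPrimal_le_sdpDual
  have h2 : p.flDualValue = p.netSDP :=
    le_antisymm hp.flDualValue_le_netSDP FunLag.Problem.netSDP_le_flDualValue
  exact ⟨fun L => ⟨hp.innerMax_le_innerSDP L, hp.dualFun_le_dualFunSDP L⟩, h2.trans h1.symm, h1⟩
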